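/- Let $D$ be a division ring and let $n\ge 1$. Let $R_n=D[x_1,\dots,x_n]$ be the ring of polynomials over $D$ in $n$ central indeterminates (the $x_i$ commute with each other and with the elements of $D$). For $m\ge 0$ let $D^m_c$ be the set of all $(a_1,\dots,a_m)\in D^m$ with $a_ia_j=a_ja_i$ for all $i,j$, and let $C(a_1,\dots,a_m)=\{d\in D : da_i=a_id \text{ for all } i\}$, a division subring of $D$ (equal to $D$ when $m=0$). A division ring $E$ is called right algebraically closed if for every nonconstant polynomial $p(x)=c_kx^k+\cdots+c_1x+c_0\in E[x]$ in one central indeterminate there is an $a\in E$ with $c_ka^k+\cdots+c_1a+c_0=0$. Then the following conditions are equivalent: (1) The set of all maximal left ideals of $R_n$ coincides with the set of all left ideals of the form $R_n(x_1-a_1)+\cdots+R_n(x_n-a_n)$, where $(a_1,\dots,a_n)\in D^n_c$. (2) Every simple left $R_n$-module is one-dimensional as a left $D$-vector space. (3) For every $(a_1,\dots,a_{n-1})\in D^{n-1}_c$, the centralizer $C(a_1,\dots,a_{n-1})$ is right algebraically closed. (For $n=1$ this says that $D$ is right algebraically closed.) (4) The set of all maximal right ideals of $R_n$ coincides with the set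 of all right ideals of the form $(x_1-a_1)R_n+\cdots+(x_n-a_n)R_n$, where $(a_1,\dots,a_n)\in D^n_c$. -/

import Mathlib

universe u

/-- The ring `R_n = D[x_1, …, x_n]` of polynomials over the (not necessarily commutative) ring `D`
in `n` central indeterminates: finite left `D`-linear combinations of monomials, where monomials
are exponent vectors `Fin n →₀ ℕ` and `(a x^s) * (b x^t) = (a * b) x^(s + t)`.
(Mathlib's `MvPolynomial` is only available over commutative coefficients.) -/
abbrev CentralPoly (D : Type*) [Ring D] (n : ℕ) : Type _ :=
  AddMonoidAlgebra D (Fin n →₀ ℕ)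

namespace CentralPoly

variable {D : Type*} [Ring D] {n : ℕ}

/-- The constant polynomial `a`. -/
noncomputable def C (a : D) : CentralPoly D n :=
  AddMonoidAlgebra.single 0 a

/-- The indeterminate `x_i`. -/
noncomputable def X (i : Fin n) : CentralPoly D n :=
  AddMonoidAlgebra.single (Finsupp.single i 1) 1

/-- The indeterminates commute with the constants. -/
theorem X_mul_C (i : Fin n) (a : D) : X i * C a = C a * (X i : CentralPoly D n) := by
  simp [X, C, AddMonoidAlgebra.single_mul_single]

/-- The indeterminates commute with each other. -/
theorem X_mul_X (i j : Fin n) : X i * X j = X j * (X i : CentralPoly D n) := by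
  simp [X, AddMonoidAlgebra.single_mul_single, add_comm]

/-- The scalar action of `D` on `D[x_1, …, x_n]` is left multiplication by constants. -/
theorem smul_eq_C_mul (a : D) (p : CentralPoly D n) : a • p = C a * p := by
  ext m
  simp [C, AddMonoidAlgebra.coeff_single_zero_mul]

/-- The left ideal `R_n (x_1 - a_1) + ⋯ + R_n (x_n - a_n)`. -/
noncomputable def leftPointIdeal (a : Fin n → D) : Ideal (CentralPoly D n) :=
  Ideal.span (Set.range fun i => X i - C (a i))

/-- The right ideal `(x_1 - a_1) R_n + ⋯ + (x_n - a_n) R_n`; right ideals of a ring `R` are the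
`Rᵐᵒᵖ`-submodules of `R`. -/
noncomputable def rightPointIdeal (a : Fin n → D) :
    Submodule (CentralPoly D n)ᵐᵒᵖ (CentralPoly D n) :=
  Submodule.span (CentralPoly D n)ᵐᵒᵖ (Set.range fun i => X i - C (a i))

end CentralPoly

/-- The set `D^n_c` of all `(a_1, …, a_n) ∈ D^n` with `a_i a_j = a_j a_i` for all `i, j`. -/
def commutingTuples (D : Type*) [Ring D] (n : ℕ) : Set (Fin n → D) :=
  {a | ∀ i j, a i * a j = a j * a i}

/-- The centralizer `C(a_1, …, a_n)` of `{a_1, …, a_n}` in `D`. It is all of `D` for `n = 0`, and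
it is a division ring if `D` is. -/
abbrev tupleCentralizer {D : Type*} [Ring D] {n : ℕ} (a : Fin n → D) : Subring D :=
  Subring.centralizer (Set.range a)

/-- `E` is right algebraically closed: every nonconstant polynomial
`p = c_m x^m + ⋯ + c_1 x + c_0` over `E` has a right root, that is, an `a` in `E` with
`c_m a^m + ⋯ + c_1 a + c_0 = 0`. (`Polynomial.eval` puts the coefficients on the left.) -/
def IsRightAlgClosed (E : Type*) [Ring E] : Prop :=
  ∀ p : Polynomial E, 0 < p.natDegree → ∃ a : E, p.eval a = 0

/-! Write `R = D[x_1, …, x_n]`. Modulo the left ideal of a commuting point `a`, every polynomial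
reduces to a constant, so a proper left ideal containing all `x_i - a_i` is that point ideal. Points
thus correspond to one-dimensional quotients, which gives (2) ⇒ (1).

(1) ⇒ (3): if `p` has coefficients commuting with `a_1, …, a_{n-1}`, then right multiplication by
`a_i` is well defined on `D[x]/D[x]p` and makes it an `R`-module. A maximal left ideal above the
annihilator of the class of `1` is the ideal of a point extending `a`, and the last coordinate of
this point is a root of `p` (`exists_ideal_ne_top_of_commuting`).

(3) ⇒ (2): a simple module needs a simultaneous eigenvector of the `x_i`. It is built one variable
at a time (`exists_eigenvector_extension`). The annihilating polynomial this requires comes from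
generic torsion (`exists_smul_eq_zero_of_central_divisible`), where Dickson's lemma and the
noetherian property of `D[x_i]` replace generic flatness.

(3) ⇔ (4): right algebraic closedness passes to the opposite ring, because linear factors can be
moved from right to left. -/

open Polynomial in
/-- A nonzero element of minimal degree generates a left ideal of polynomials over a division ring. -/
theorem Polynomial.mem_span_singleton_of_degree_minimal {D : Type*} [DivisionRing D]
    {I : Ideal D[X]} {g : D[X]} (hg : g ∈ I) (hg0 : g ≠ 0)
    (hmin : ∀ f ∈ I, f ≠ 0 → g.natDegree ≤ f.natDegree) {f : D[X]} (hf : f ∈ I) :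
    f ∈ Ideal.span {g} := by
  induction hd : f.degree using WellFoundedLT.induction generalizing f with
  | ind d ih =>
    by_cases hf0 : f = 0
    · simp [hf0]
    have hle := hmin f hf hf0
    set c : D := f.leadingCoeff * g.leadingCoeff⁻¹ with hc
    have hlg : g.leadingCoeff ≠ 0 := leadingCoeff_ne_zero.2 hg0
    have hlf : f.leadingCoeff ≠ 0 := leadingCoeff_ne_zero.2 hf0
    have hc0 : c ≠ 0 := mul_ne_zero hlf (inv_ne_zero hlg)
    set h : D[X] := C c * X ^ (f.natDegree - g.natDegree) * g with hh
    have hhl : h.leadingCoeff = f.leadingCoeff := by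
      simp [hh, hc, mul_assoc, hlg]
    have hhd : f.degree = h.degree := by
      rw [hh, degree_mul, degree_C_mul_X_pow _ hc0, degree_eq_natDegree hf0,
        degree_eq_natDegree hg0]
      norm_cast
      omega
    have hlt : (f - h).degree < d := hd ▸ degree_sub_lt_left hhd hf0 hhl.symm
    have hhI : h ∈ Ideal.span {g} := Ideal.mul_mem_left _ _ (Ideal.mem_span_singleton_self g)
    have hsub : Ideal.span {g} ≤ I := (Ideal.span_singleton_le_iff_mem I).2 hg
    have := ih _ hlt (I.sub_mem hf (hsub hhI)) rfl
    simpa using Ideal.add_mem _ this hhI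

/-- Left ideals of the polynomial ring over a division ring are principal. -/
instance Polynomial.isPrincipalIdealRing_of_divisionRing {D : Type*} [DivisionRing D] :
    IsPrincipalIdealRing (Polynomial D) where
  principal I := by
    by_cases h : ∃ f ∈ I, f ≠ 0
    · obtain ⟨g, ⟨hg, hg0⟩, hmin⟩ := (measure (Polynomial.natDegree (R := D))).wf.has_min
        {f | f ∈ I ∧ f ≠ 0} h
      refine ⟨g, le_antisymm (fun f hf => ?_) ((Ideal.span_singleton_le_iff_mem I).2 hg)⟩
      exact Polynomial.mem_span_singleton_of_degree_minimal hg hg0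
        (fun f hf hf0 => not_lt.1 (hmin f ⟨hf, hf0⟩)) hf
    · refine ⟨0, le_antisymm (fun f hf => ?_) (by simp)⟩
      by_contra h0
      exact h ⟨f, hf, fun h => h0 (by simp [h])⟩

/-! ### Roots, linear factors and left-right symmetry. -/

namespace Polynomial

/-- Right division by `X - C a` when `a` is a right root. -/
theorem exists_eq_mul_X_sub_C {E : Type*} [Ring E] {p : E[X]} {a : E} (h : p.eval a = 0) :
    ∃ q : E[X], p = q * (X - C a) := by
  suffices H : ∀ p : E[X], ∃ q : E[X], p - C (p.eval a) = q * (X - C a) by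
    simpa [h] using H p
  intro p
  induction p using Polynomial.induction_on' with
  | add p q hp hq =>
    obtain ⟨r, hr⟩ := hp
    obtain ⟨s, hs⟩ := hq
    exact ⟨r + s, by rw [add_mul, ← hr, ← hs, eval_add, C_add]; abel⟩
  | monomial n c =>
    refine ⟨C c * ∑ i ∈ Finset.range n, X ^ i * C a ^ (n - 1 - i), ?_⟩
    rw [mul_assoc, (commute_X (C a)).geom_sum₂_mul, eval_monomial, ← C_mul_X_pow_eq_monomial]
    simp [mul_sub]

theorem exists_natDegree_eq_of_eval_eq_zero {E : Type*} [Ring E] {p : E[X]} {a : E}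
    (h : p.eval a = 0) (hp : p ≠ 0) :
    ∃ q : E[X], p = q * (X - C a) ∧ q ≠ 0 ∧ p.natDegree = q.natDegree + 1 := by
  obtain ⟨q, rfl⟩ := exists_eq_mul_X_sub_C h
  have hq : q ≠ 0 := by rintro rfl; simp at hp
  have : Nontrivial E := by
    by_contra hE
    rw [not_nontrivial_iff_subsingleton] at hE
    exact hq (Subsingleton.elim _ _)
  refine ⟨q, rfl, hq, ?_⟩
  rw [natDegree_mul' (by simpa using hq), natDegree_X_sub_C]

/-- Over a right algebraically closed ring in which nonzero elements are invertible,
nonconstant polynomials are divisible on the left by some `X - C a`. -/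
theorem exists_eq_X_sub_C_mul {E : Type*} [Ring E] (hE : ∀ c : E, c ≠ 0 → IsUnit c)
    (h : IsRightAlgClosed E) (p : E[X]) (hp : 0 < p.natDegree) :
    ∃ (a : E) (q : E[X]), p = (X - C a) * q := by
  induction hd : p.natDegree using Nat.strong_induction_on generalizing p with
  | _ d ih =>
    obtain ⟨b, hb⟩ := h p hp
    obtain ⟨q, rfl, hq0, hdeg⟩ := exists_natDegree_eq_of_eval_eq_zero hb (by rintro rfl; simp at hp)
    rcases Nat.eq_zero_or_pos q.natDegree with hq | hq
    · obtain ⟨c, rfl⟩ := natDegree_eq_zero.1 hq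
      obtain ⟨u, rfl⟩ := hE c (by rintro rfl; simp at hq0)
      -- Moving the unit across conjugates the root: `u(X - b) = (X - ubu⁻¹)u`.
      refine ⟨u * b * (↑u⁻¹ : E), C u, ?_⟩
      rw [mul_sub, sub_mul, ← C_mul, ← C_mul, mul_assoc _ (↑u⁻¹ : E), Units.inv_mul, mul_one, X_mul]
    · obtain ⟨a, r, hr⟩ := ih q.natDegree (by omega) q hq rfl
      exact ⟨a, r * (X - C b), by rw [← mul_assoc, ← hr]⟩

end Polynomial

/-- A right root in `Eᵐᵒᵖ` amounts to a left factor `X - a` over `E`, which `exists_eq_X_sub_C_mul`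
supplies. -/
theorem IsRightAlgClosed.op {E : Type*} [Ring E] (hE : ∀ c : E, c ≠ 0 → IsUnit c)
    (h : IsRightAlgClosed E) : IsRightAlgClosed Eᵐᵒᵖ := by
  intro p hp
  obtain ⟨P, rfl⟩ := (Polynomial.opRingEquiv E).surjective p
  obtain ⟨a, q, hq⟩ := Polynomial.exists_eq_X_sub_C_mul hE h P.unop (by simpa using hp)
  refine ⟨MulOpposite.op a, ?_⟩
  have : P = MulOpposite.op q * MulOpposite.op (Polynomial.X - Polynomial.C a) := by
    rw [← MulOpposite.op_mul, ← hq, MulOpposite.op_unop]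
  rw [this, map_mul]
  have h2 : (Polynomial.opRingEquiv E) (MulOpposite.op (Polynomial.X - Polynomial.C a)) =
      Polynomial.X - Polynomial.C (MulOpposite.op a) := by
    rw [MulOpposite.op_sub, map_sub, Polynomial.opRingEquiv_op_X, Polynomial.opRingEquiv_op_C]
  rw [h2, Polynomial.eval_mul_X_sub_C]

theorem IsRightAlgClosed.of_ringEquiv {E F : Type*} [Ring E] [Ring F] (e : E ≃+* F)
    (h : IsRightAlgClosed E) : IsRightAlgClosed F := by
  intro p hp
  obtain ⟨a, ha⟩ := h (p.map (e.symm : F →+* E)) (by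
    rwa [Polynomial.natDegree_map_eq_of_injective e.symm.injective])
  refine ⟨e a, e.symm.injective ?_⟩
  rw [map_zero, ← ha, Polynomial.eval_map]
  exact (Polynomial.hom_eval₂ p (RingHom.id F) (e.symm : F →+* E) (e a)).trans (by simp)

theorem isUnit_of_mem_tupleCentralizer {D : Type*} [DivisionRing D] {n : ℕ} {a : Fin n → D}
    (c : tupleCentralizer a) (hc : c ≠ 0) : IsUnit c := by
  have hc' : (c : D) ≠ 0 := fun h => hc (Subtype.ext h)
  have hmem : (c : D)⁻¹ ∈ tupleCentralizer a := by
    rintro x hx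
    have h : Commute x c := c.2 x hx
    exact (h.inv_right₀ : _)
  exact ⟨⟨c, ⟨_, hmem⟩, Subtype.ext (mul_inv_cancel₀ hc'), Subtype.ext (inv_mul_cancel₀ hc')⟩, rfl⟩

/-! ### Leading ideals, central torsion and generic torsion. -/

section ColonIdeal

variable {A M ι : Type*} [Ring A] [AddCommGroup M] [Module A M] [LinearOrder ι]

/-- The left ideal of all `a` such that `a • e β` lies in the span of the `e γ` with `γ < β`. -/
def leadingIdeal (A : Type*) [Ring A] [Module A M] (e : ι → M) (β : ι) : Ideal A :=
  (Submodule.span A (e '' Set.Iio β)).comap (LinearMap.toSpanSingleton A M (e β))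

theorem mem_leadingIdeal {e : ι → M} {β : ι} {a : A} :
    a ∈ leadingIdeal A e β ↔ a • e β ∈ Submodule.span A (e '' Set.Iio β) := Iff.rfl

theorem exists_mem_span_image_Iic {e : ι → M} {s : Set ι} (h : s.Nonempty) {u : M}
    (hu : u ∈ Submodule.span A (e '' s)) :
    ∃ γ ∈ s, u ∈ Submodule.span A (e '' Set.Iic γ) := by
  induction hu using Submodule.span_induction with
  | mem x hx =>
    obtain ⟨γ, hγ, rfl⟩ := hx
    exact ⟨γ, hγ, Submodule.subset_span ⟨γ, le_rfl, rfl⟩⟩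
  | zero => exact ⟨h.some, h.some_mem, Submodule.zero_mem _⟩
  | add x y _ _ hx hy =>
    obtain ⟨γ, hγ, hx⟩ := hx
    obtain ⟨δ, hδ, hy⟩ := hy
    refine ⟨max γ δ, ?_, Submodule.add_mem _ ?_ ?_⟩
    · rcases max_choice γ δ with h | h <;> rw [h] <;> assumption
    · exact Submodule.span_mono (Set.image_mono (Set.Iic_subset_Iic.2 (le_max_left _ _))) hx
    · exact Submodule.span_mono (Set.image_mono (Set.Iic_subset_Iic.2 (le_max_right _ _))) hy
  | smul a x _ hx =>
    obtain ⟨γ, hγ, hx⟩ := hx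
    exact ⟨γ, hγ, Submodule.smul_mem _ _ hx⟩

/-- Descent on the top term `c • e β` of `u`: if `q • u` lies in the bottom span, then `q * c` is in
the leading ideal at `β`. Hence so is `c`, and the top term can be rewritten by smaller ones. -/
theorem mem_span_bot_of_smul_mem [WellFoundedLT ι] {e : ι → M} {β₀ : ι} (hβ₀ : ∀ β, β₀ ≤ β)
    {q : A} (hsat : ∀ β c, q * c ∈ leadingIdeal A e β → c ∈ leadingIdeal A e β) (β : ι) {u : M}
    (hu : u ∈ Submodule.span A (e '' Set.Iic β)) (hqu : q • u ∈ Submodule.span A {e β₀}) :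
    u ∈ Submodule.span A {e β₀} := by
  induction β using WellFoundedLT.induction with
  | ind β ih =>
    rcases (hβ₀ β).eq_or_lt with rfl | hlt
    · have : Set.Iic β₀ = {β₀} := Set.ext fun γ => ⟨fun h => le_antisymm h (hβ₀ γ), fun h => h.le⟩
      rwa [this, Set.image_singleton] at hu
    · suffices h : u ∈ Submodule.span A (e '' Set.Iio β) by
        obtain ⟨γ, hγ, hu'⟩ := exists_mem_span_image_Iic ⟨β₀, hlt⟩ h
        exact ih γ hγ hu'
      rw [← Set.Iio_insert, Set.image_insert_eq, Submodule.mem_span_insert] at hu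
      obtain ⟨c, v, hv, rfl⟩ := hu
      have hb : Submodule.span A {e β₀} ≤ Submodule.span A (e '' Set.Iio β) :=
        Submodule.span_mono (Set.singleton_subset_iff.2 ⟨β₀, hlt, rfl⟩)
      have hc : q * c ∈ leadingIdeal A e β := by
        rw [mem_leadingIdeal, mul_smul]
        have := Submodule.sub_mem _ (hb hqu) (Submodule.smul_mem _ q hv)
        rwa [smul_add, add_sub_cancel_right] at this
      exact Submodule.add_mem _ (mem_leadingIdeal.1 (hsat β c hc)) hv

end ColonIdeal

/-- The set of all `c` with `s * c ∈ I`, for a central element `s`. -/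
def Ideal.centralColon {A : Type*} [Ring A] (I : Ideal A) (s : A) (hs : s ∈ Subring.center A) :
    Ideal A where
  carrier := {c | s * c ∈ I}
  add_mem' {a b} ha hb := by
    rw [Set.mem_ofPred_eq, mul_add]
    exact I.add_mem ha hb
  zero_mem' := by simp
  smul_mem' a c hc := by
    rw [Set.mem_ofPred_eq, smul_eq_mul, ← mul_assoc, ← Subring.mem_center_iff.1 hs a, mul_assoc]
    exact I.mul_mem_left a hc

/-- In a left noetherian domain, the central torsion modulo a left ideal is killed by a single
nonzero central element. -/
theorem exists_central_saturation {A : Type*} [Ring A] [IsDomain A] [IsNoetherianRing A]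
    (I : Ideal A) : ∃ s ∈ Subring.center A, s ≠ 0 ∧
      ∀ q ∈ Subring.center A, q ≠ 0 → ∀ c, q * c ∈ I → s * c ∈ I := by
  obtain ⟨_, ⟨s, hs, hs0, rfl⟩, hmax⟩ := set_has_maximal_iff_noetherian.2 ‹IsNoetherianRing A›
    {J : Ideal A | ∃ s, ∃ hs : s ∈ Subring.center A, s ≠ 0 ∧ J = I.centralColon s hs}
    ⟨_, 1, Subring.one_mem _, one_ne_zero, rfl⟩
  refine ⟨s, hs, hs0, fun q hq hq0 c hc => ?_⟩
  -- Passing from `s` to `q * s` enlarges the colon ideal, so maximality makes the two equal.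
  have h := hmax _ ⟨q * s, Subring.mul_mem _ hq hs, mul_ne_zero hq0 hs0, rfl⟩
  have hle : I.centralColon s hs ≤ I.centralColon (q * s) (Subring.mul_mem _ hq hs) := by
    intro x hx
    change q * s * x ∈ I
    rw [mul_assoc]
    exact I.mul_mem_left q hx
  by_contra hcs
  refine h (lt_of_le_of_ne hle fun heq => hcs ?_)
  change c ∈ I.centralColon s hs
  rw [heq]
  change q * s * c ∈ I
  rw [Subring.mem_center_iff.1 hs q, mul_assoc]
  exact I.mul_mem_left s hc

/-- A monotone map from a well-quasi-order to a noetherian order has finite range. -/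
theorem Monotone.finite_range_of_wellQuasiOrdered {α β : Type*} [Preorder α] [PartialOrder β]
    [WellFoundedGT β] (hα : WellQuasiOrdered ((· ≤ ·) : α → α → Prop)) {f : α → β}
    (hf : Monotone f) : (Set.range f).Finite := by
  by_contra hinf
  let g := Set.Infinite.natEmbedding _ hinf
  -- Preimages of distinct values have a monotone subsequence; its image is stationary by the
  -- ascending chain condition, yet injective.
  choose b hb using fun k => (g k).2
  obtain ⟨φ, hφ⟩ := hα.exists_monotone_subseq b
  let F : ℕ →o β := ⟨fun k => f (b (φ k)), fun i j hij => hf (hφ i j hij)⟩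
  obtain ⟨N, hN⟩ := WellFoundedGT.monotone_chain_condition F
  have h1 : f (b (φ N)) = f (b (φ (N + 1))) := hN (N + 1) (Nat.le_succ N)
  rw [hb, hb] at h1
  have h2 := φ.injective (g.injective (Subtype.ext h1))
  omega

/-- Generic torsion: let `e` be a spanning family of the `A`-module `M` indexed by monomials, such
that multiplication by monomials is induced by endomorphisms. If the vector `e 0` is divisible by
all nonzero central elements of `A`, then it is a torsion element. -/
theorem exists_smul_eq_zero_of_central_divisible {A M σ : Type*} [Ring A] [IsDomain A]
    [IsNoetherianRing A] [AddCommGroup M] [Module A M] [Finite σ] [LinearOrder σ] (z : A)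
    (hz : z ∈ Subring.center A)
    (hzu : ∀ s, s ≠ 0 → 1 + z * s ≠ 0 ∧ ¬ IsUnit (1 + z * s)) (e : (σ →₀ ℕ) → M)
    (hshift : ∀ δ, ∃ T : M →ₗ[A] M, ∀ β, T (e β) = e (β + δ))
    (hspan : Submodule.span A (Set.range e) = ⊤)
    (hdiv : ∀ q ∈ Subring.center A, q ≠ 0 → ∃ u : M, q • u = e 0) :
    ∃ a : A, a ≠ 0 ∧ a • e 0 = 0 := by
  let o : MonomialOrder σ := MonomialOrder.lex
  let e' : o.syn → M := fun β => e (o.toSyn.symm β)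
  have he' : ∀ β, e' (o.toSyn β) = e β := fun β => by simp [e']
  let I : (σ →₀ ℕ) → Ideal A := fun β => leadingIdeal A e' (o.toSyn β)
  have hI : Monotone I := by
    intro β γ hβγ a ha
    obtain ⟨δ, rfl⟩ := exists_add_of_le hβγ
    obtain ⟨T, hT⟩ := hshift δ
    rw [mem_leadingIdeal] at ha ⊢
    have h := Submodule.mem_map_of_mem (f := T) ha
    rw [map_smul, he', hT, ← he', Submodule.map_span, Set.image_image] at h
    refine Submodule.span_mono ?_ h
    rintro _ ⟨κ, hκ, rfl⟩
    refine ⟨κ + o.toSyn δ, ?_, ?_⟩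
    · rw [Set.mem_Iio, map_add]
      exact add_lt_add_left (Set.mem_Iio.1 hκ) _
    · simp [e', hT]
  -- Dickson's lemma: exponent vectors are well-quasi-ordered, so only finitely many leading ideals
  -- occur and one product `S` serves them all.
  have hfin : (Set.range I).Finite :=
    hI.finite_range_of_wellQuasiOrdered WellQuasiOrderedLE.wqo
  choose s hs hs0 hsat using fun J : Ideal A => exists_central_saturation J
  let s' : Ideal A → Subring.center A := fun J => ⟨s J, hs J⟩
  let S : Subring.center A := ∏ J ∈ hfin.toFinset, s' J
  have hS0 : (S : A) ≠ 0 := by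
    have : S ≠ 0 := Finset.prod_ne_zero_iff.2 fun J _ h => hs0 J (congrArg Subtype.val h)
    exact fun h => this (Subtype.ext h)
  have hzS := Subring.mul_mem _ hz S.2
  -- `S` kills central torsion modulo every leading ideal and `q ≡ 1` modulo `S`, so there is no
  -- `q`-torsion: `q * c ∈ I β` gives `S * c ∈ I β`, hence `c ∈ I β`.
  set q : A := 1 + z * S with hq
  have hqc : q ∈ Subring.center A := Subring.add_mem _ (Subring.one_mem _) hzS
  have hqu : ¬ IsUnit q := (hzu _ hS0).2
  have hq0 : q ≠ 0 := (hzu _ hS0).1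
  have hqI : ∀ β c, q * c ∈ leadingIdeal A e' β → c ∈ leadingIdeal A e' β := by
    intro β c hc
    obtain ⟨β, rfl⟩ := o.toSyn.surjective β
    have h1 : s (I β) * c ∈ I β := hsat (I β) q hqc hq0 c hc
    have h2 : (S : A) * c ∈ I β := by
      have hmem : I β ∈ hfin.toFinset := by simp
      have : (S : A) = ((∏ J ∈ hfin.toFinset.erase (I β), s' J : Subring.center A) : A) *
          s (I β) := by
        exact congrArg Subtype.val (Finset.prod_erase_mul hfin.toFinset s' hmem).symm
      rw [this, mul_assoc]
      exact Ideal.mul_mem_left _ _ h1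
    have h3 : c = q * c - z * (S * c) := by rw [hq]; noncomm_ring
    rw [h3]
    exact Ideal.sub_mem _ hc (Ideal.mul_mem_left _ _ h2)
  obtain ⟨u, hu⟩ := hdiv q hqc hq0
  have hbot : ∀ β : o.syn, 0 ≤ β := o.zero_le
  have he0 : e' 0 = e 0 := by simp [e']
  have hu' : u ∈ Submodule.span A (e' '' Set.univ) := by
    rw [Set.image_univ, show Set.range e' = Set.range e from o.toSyn.symm.surjective.range_comp e,
      hspan]
    exact Submodule.mem_top
  obtain ⟨β, -, hβ⟩ := exists_mem_span_image_Iic Set.univ_nonempty hu'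
  have := mem_span_bot_of_smul_mem hbot hqI β hβ
    (by rw [hu, he0]; exact Submodule.mem_span_singleton_self _)
  obtain ⟨a, rfl⟩ := Submodule.mem_span_singleton.1 this
  -- Now `u = a • e 0`, so `e 0 = (q * a) • e 0`; and `q * a ≠ 1` since the central `q` is not a
  -- unit.
  refine ⟨1 - q * a, fun h => hqu ?_, ?_⟩
  · have h1 : q * a = 1 := (sub_eq_zero.1 h).symm
    exact ⟨⟨q, a, h1, by rw [Subring.mem_center_iff.1 hqc a, h1]⟩, rfl⟩
  · rw [sub_smul, one_smul, mul_smul, ← he0, hu, he0, sub_self]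

/-! ### Calculus in the polynomial ring; the subrings `D[x_i]`. -/

namespace CentralPoly

variable {D : Type*} [Ring D] {n : ℕ}

/-- The embedding of the constants as a ring homomorphism. -/
noncomputable def CHom : D →+* CentralPoly D n := AddMonoidAlgebra.singleZeroRingHom

theorem CHom_apply (a : D) : CHom a = (C a : CentralPoly D n) := rfl

theorem C_mul (a b : D) : (C (a * b) : CentralPoly D n) = C a * C b := map_mul CHom a b

theorem C_one : (C 1 : CentralPoly D n) = 1 := map_one CHom

theorem C_zero : (C 0 : CentralPoly D n) = 0 := map_zero CHom

/-- The monomial with exponent vector `β`. -/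
noncomputable def monomial (β : Fin n →₀ ℕ) : CentralPoly D n := AddMonoidAlgebra.single β 1

theorem monomial_zero : (monomial 0 : CentralPoly D n) = 1 := rfl

theorem monomial_add (β γ : Fin n →₀ ℕ) :
    (monomial (β + γ) : CentralPoly D n) = monomial β * monomial γ := by
  simp [monomial, AddMonoidAlgebra.single_mul_single]

theorem single_eq_C_mul_monomial (β : Fin n →₀ ℕ) (d : D) :
    AddMonoidAlgebra.single β d = C d * (monomial β : CentralPoly D n) := by
  simp [C, monomial, AddMonoidAlgebra.single_mul_single]

theorem monomial_single (i : Fin n) (k : ℕ) :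
    (monomial (Finsupp.single i k) : CentralPoly D n) = X i ^ k := by
  induction k with
  | zero => simp [monomial_zero]
  | succ k ih => rw [Finsupp.single_add, monomial_add, ih, pow_succ]; rfl

theorem induction_C_mul_monomial {P : CentralPoly D n → Prop} (r : CentralPoly D n)
    (h0 : P 0) (hadd : ∀ p q, P p → P q → P (p + q)) (hmon : ∀ d β, P (C d * monomial β)) :
    P r := by
  induction r using AddMonoidAlgebra.induction_linear with
  | zero => exact h0
  | add p q hp hq => exact hadd p q hp hq
  | single β d => rw [single_eq_C_mul_monomial]; exact hmon d β

theorem induction_C_X {P : CentralPoly D n → Prop} (r : CentralPoly D n)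
    (hadd : ∀ p q, P p → P q → P (p + q)) (hmul : ∀ p q, P p → P q → P (p * q))
    (hC : ∀ d, P (C d)) (hX : ∀ i, P (X i)) : P r := by
  refine induction_C_mul_monomial r (C_zero (D := D) ▸ hC 0) hadd fun d β => hmul _ _ (hC d) ?_
  induction β using Finsupp.induction_linear with
  | zero => rw [monomial_zero, ← C_one]; exact hC 1
  | add β γ hβ hγ => rw [monomial_add]; exact hmul _ _ hβ hγ
  | single i k =>
    rw [monomial_single]
    induction k with
    | zero => rw [pow_zero, ← C_one]; exact hC 1
    | succ k ih => rw [pow_succ]; exact hmul _ _ ih (hX i)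

theorem mem_center_of_commute {s : CentralPoly D n} (hC : ∀ d, Commute (C d) s)
    (hX : ∀ i, Commute (X i) s) : s ∈ Subring.center (CentralPoly D n) := by
  refine Subring.mem_center_iff.2 fun r => ?_
  change Commute r s
  exact induction_C_X (P := fun r => Commute r s) r (fun _ _ hp hq => hp.add_left hq) (fun _ _ hp hq => hp.mul_left hq) hC hX

/-- Evaluation of one-variable polynomials at `X i`. -/
noncomputable def evalX (i : Fin n) : Polynomial D →+* CentralPoly D n :=
  Polynomial.eval₂RingHom' CHom (X i) fun a => (X_mul_C i a).symm

@[simp]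
theorem evalX_C (i : Fin n) (a : D) : evalX i (Polynomial.C a) = C a :=
  Polynomial.eval₂_C (CHom : D →+* CentralPoly D n) (X i)

@[simp]
theorem evalX_X (i : Fin n) : evalX i (Polynomial.X : Polynomial D) = X i :=
  Polynomial.eval₂_X (CHom : D →+* CentralPoly D n) (X i)

theorem commute_X_evalX (i j : Fin n) (p : Polynomial D) : Commute (X j) (evalX i p) := by
  induction p using Polynomial.induction_on with
  | C a => rw [evalX_C]; exact X_mul_C j a
  | add p q hp hq => rw [map_add]; exact hp.add_right hq
  | monomial k a h =>
    rw [pow_succ, ← mul_assoc, map_mul, evalX_X]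
    exact h.mul_right (X_mul_X j i)

/-- Makes multiplication by a monomial `D[x_i]`-linear on modules, as the shift maps of the generic
torsion argument require. -/
theorem commute_monomial_evalX (i : Fin n) (β : Fin n →₀ ℕ) (p : Polynomial D) :
    Commute (monomial β) (evalX i p) := by
  induction β using Finsupp.induction_linear with
  | zero => rw [monomial_zero]; exact Commute.one_left _
  | add β γ hβ hγ => rw [monomial_add]; exact hβ.mul_left hγ
  | single j k => rw [monomial_single]; exact (commute_X_evalX i j p).pow_left k

theorem evalX_mem_center (i : Fin n) {q : Polynomial D} (hq : q ∈ Subring.center (Polynomial D)) :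
    evalX i q ∈ Subring.center (CentralPoly D n) := by
  refine mem_center_of_commute (fun d => ?_) (fun j => commute_X_evalX i j q)
  rw [← evalX_C i, Commute, SemiconjBy, ← map_mul, ← map_mul, Subring.mem_center_iff.1 hq]

end CentralPoly

theorem Polynomial.X_mem_center {D : Type*} [Ring D] :
    (Polynomial.X : Polynomial D) ∈ Subring.center (Polynomial D) :=
  Subring.mem_center_iff.2 fun p => (Polynomial.X_mul (p := p)).symm

/-! ### Torsion and simultaneous eigenvectors in simple modules. -/

namespace CentralPoly

variable {D : Type*} [DivisionRing D] {n : ℕ} {M : Type*} [AddCommGroup M]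
  [Module (CentralPoly D n) M]

/-- Every element of a simple module is torsion with respect to each indeterminate. -/
theorem exists_evalX_smul_eq_zero [IsSimpleModule (CentralPoly D n) M] (i : Fin n) (m : M)
    (hm : m ≠ 0) : ∃ p : Polynomial D, p ≠ 0 ∧ evalX i p • m = 0 := by
  by_cases h : ∃ q ∈ Subring.center (Polynomial D), q ≠ 0 ∧ evalX i q • m = 0
  · obtain ⟨q, -, hq⟩ := h
    exact ⟨q, hq⟩
  push Not at h
  let : Module (Polynomial D) M := Module.compHom M (evalX i)
  have hsmul : ∀ (p : Polynomial D) (x : M), p • x = evalX i p • x := fun _ _ => rfl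
  have hunit : ∀ s : Polynomial D, s ≠ 0 →
      1 + Polynomial.X * s ≠ 0 ∧ ¬ IsUnit (1 + Polynomial.X * s) := by
    intro s hs
    have hd : (1 + Polynomial.X * s).natDegree = s.natDegree + 1 := by
      rw [add_comm, ← Polynomial.C_1, Polynomial.natDegree_add_C, Polynomial.natDegree_X_mul hs]
    refine ⟨fun h => by simp [h] at hd, fun hu => ?_⟩
    have := Polynomial.natDegree_eq_zero_of_isUnit hu
    omega
  have key := exists_smul_eq_zero_of_central_divisible (A := Polynomial D) (M := M)
    Polynomial.X Polynomial.X_mem_center hunit (fun β : Fin n →₀ ℕ => (monomial β : CentralPoly D n) • m)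
    (fun δ => ⟨{ toFun := fun x => (monomial δ : CentralPoly D n) • x
                 map_add' := fun x y => smul_add _ x y
                 map_smul' := fun p x => by
                  rw [hsmul, smul_smul, (commute_monomial_evalX i δ p).eq, mul_smul]; rfl },
      fun β => by
        change (monomial δ : CentralPoly D n) • (monomial β : CentralPoly D n) • m = _
        rw [smul_smul, ← monomial_add, add_comm]⟩)
    (by
      refine eq_top_iff.2 fun x _ => ?_
      obtain ⟨r, rfl⟩ := IsSimpleModule.toSpanSingleton_surjective (CentralPoly D n) hm x
      rw [LinearMap.toSpanSingleton_apply]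
      refine induction_C_mul_monomial (P := fun r => r • m ∈ Submodule.span (Polynomial D)
        (Set.range fun β : Fin n →₀ ℕ => (monomial β : CentralPoly D n) • m)) r ?_ ?_ ?_
      · rw [zero_smul]; exact Submodule.zero_mem _
      · intro p q hp hq
        rw [add_smul]; exact Submodule.add_mem _ hp hq
      · intro d β
        rw [mul_smul, ← evalX_C i d]
        exact Submodule.smul_mem _ (Polynomial.C d) (Submodule.subset_span ⟨β, rfl⟩))
    (by
      intro q hq hq0
      -- As `q • m ≠ 0` generates `M`, `m = r • q • m = q • r • m` by centrality of `q`.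
      obtain ⟨r, hr⟩ := IsSimpleModule.toSpanSingleton_surjective (CentralPoly D n)
        (h q hq hq0) m
      refine ⟨r • m, ?_⟩
      rw [LinearMap.toSpanSingleton_apply] at hr
      rw [hsmul, smul_smul, ← Subring.mem_center_iff.1 (evalX_mem_center i hq) r, mul_smul, hr,
        monomial_zero, one_smul])
  obtain ⟨p, hp, hpm⟩ := key
  exact ⟨p, hp, by simpa [hsmul, monomial_zero] using hpm⟩

/-- Extending a simultaneous eigenvector by one indeterminate. -/
theorem exists_eigenvector_extension {S : Set (Fin n)} {a : Fin n → D} {E : Subring D}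
    (hE : ∀ d, d ∈ E ↔ ∀ i ∈ S, d * a i = a i * d) (hRAC : IsRightAlgClosed E) (j : Fin n)
    {m : M} (hm : m ≠ 0)
    (ha : ∀ i ∈ S, (X i : CentralPoly D n) • m = (C (a i) : CentralPoly D n) • m)
    (htors : ∃ p : Polynomial D, p ≠ 0 ∧ evalX j p • m = 0) :
    ∃ b ∈ E, ∃ m' : M, m' ≠ 0 ∧
      (∀ i ∈ S, (X i : CentralPoly D n) • m' = (C (a i) : CentralPoly D n) • m') ∧
      (X j : CentralPoly D n) • m' = (C b : CentralPoly D n) • m' := by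
  -- The degree is minimal over all nonzero eigenvectors with eigenvalues `a`, not only the given
  -- one, so `m` may be replaced.
  obtain ⟨p₀, ⟨hp₀, m, hm, ha, hpm₀⟩, hmin⟩ := (measure (Polynomial.natDegree (R := D))).wf.has_min
    {p | p ≠ 0 ∧ ∃ m : M, m ≠ 0 ∧
      (∀ i ∈ S, (X i : CentralPoly D n) • m = (C (a i) : CentralPoly D n) • m) ∧
      evalX j p • m = 0}
    (by obtain ⟨p, hp, hpm⟩ := htors; exact ⟨p, hp, m, hm, ha, hpm⟩)
  have hlc : p₀.leadingCoeff ≠ 0 := Polynomial.leadingCoeff_ne_zero.2 hp₀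
  obtain ⟨p, hp⟩ : ∃ p : Polynomial D, p = Polynomial.C p₀.leadingCoeff⁻¹ * p₀ := ⟨_, rfl⟩
  have hmonic : p.Monic := by
    rw [Polynomial.Monic, hp, Polynomial.leadingCoeff_mul, Polynomial.leadingCoeff_C,
      inv_mul_cancel₀ hlc]
  have hpm : evalX j p • m = 0 := by rw [hp, map_mul, mul_smul, hpm₀, smul_zero]
  have hdeg : p.natDegree = p₀.natDegree := by
    rw [hp, Polynomial.natDegree_C_mul (inv_ne_zero hlc)]
  have hmin' : ∀ q : Polynomial D, q.natDegree < p.natDegree → ∀ m' : M, m' ≠ 0 →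
      (∀ i ∈ S, (X i : CentralPoly D n) • m' = (C (a i) : CentralPoly D n) • m') →
      evalX j q • m' = 0 → q = 0 := by
    intro q hq m' hm' ha' hqm
    by_contra hq0
    exact hmin q ⟨hq0, m', hm', ha', hqm⟩ (show q.natDegree < p₀.natDegree from hdeg ▸ hq)
  have hpos : 0 < p.natDegree := by
    rw [Nat.pos_iff_ne_zero]
    intro h0
    rw [hmonic.natDegree_eq_zero.1 h0, map_one, one_smul] at hpm
    exact hm hpm
  have hcoeff : ∀ k, p.coeff k ∈ E := by
    intro k
    rw [hE]
    intro i hi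
    -- `p` is monic, so this commutator has smaller degree; it kills `m` because `p a_i m = p x_i m
    -- = x_i p m = 0`.
    have hzero : p * Polynomial.C (a i) - Polynomial.C (a i) * p = 0 := by
      refine hmin' _ ?_ m hm ha ?_
      · suffices h : (p * Polynomial.C (a i) - Polynomial.C (a i) * p).natDegree ≤
            p.natDegree - 1 by omega
        refine Polynomial.natDegree_le_iff_coeff_eq_zero.2 fun N hN => ?_
        rw [Polynomial.coeff_sub, Polynomial.coeff_mul_C, Polynomial.coeff_C_mul]
        rcases (show p.natDegree ≤ N by omega).eq_or_lt with rfl | hlt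
        · rw [hmonic.coeff_natDegree, one_mul, mul_one, sub_self]
        · rw [Polynomial.coeff_eq_zero_of_natDegree_lt hlt, zero_mul, mul_zero, sub_self]
      · rw [map_sub, map_mul (evalX j) p, map_mul _ _ p, evalX_C, sub_smul, mul_smul, mul_smul, hpm, smul_zero,
          sub_zero, ← ha i hi, smul_smul, ← (commute_X_evalX j i p).eq, mul_smul, hpm, smul_zero]
    have := congrArg (fun f => Polynomial.coeff f k) (sub_eq_zero.1 hzero)
    simpa using this
  have hpE : (↑p.coeffs : Set D) ⊆ E := by
    intro c hc
    obtain ⟨k, -, rfl⟩ := Polynomial.mem_coeffs_iff.1 hc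
    exact hcoeff k
  set P : Polynomial E := p.toSubring E hpE with hP
  have hPmap : P.map E.subtype = p := Polynomial.map_toSubring p E hpE
  have hPdeg : P.natDegree = p.natDegree := Polynomial.natDegree_toSubring p E hpE
  obtain ⟨b, hb⟩ := hRAC P (hPdeg ▸ hpos)
  obtain ⟨Q, hQ, hQ0, hQdeg⟩ := Polynomial.exists_natDegree_eq_of_eval_eq_zero hb (by
    rintro h; rw [h] at hPdeg; simp at hPdeg; omega)
  have hbE : ∀ i ∈ S, (b : D) * a i = a i * b := (hE b).1 b.2
  refine ⟨b, b.2, m, hm, ha, ?_⟩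
  -- Otherwise `(x_j - b)m` is again an eigenvector for `a`, as `b` commutes with the `a_i`, and it
  -- is killed by `Q` of smaller degree.
  by_contra hne
  have hm' : evalX j (Polynomial.X - Polynomial.C (b : D)) • m ≠ 0 := by
    rw [map_sub, evalX_X, evalX_C, sub_smul]
    exact sub_ne_zero.2 hne
  have hQz : Q.map E.subtype = 0 := by
    refine hmin' _ ?_ _ hm' ?_ ?_
    · rw [Polynomial.natDegree_map_eq_of_injective E.subtype_injective]
      omega
    · intro i hi
      have hcomm : Commute (evalX j (Polynomial.X - Polynomial.C (b : D)))
          (C (a i) : CentralPoly D n) := by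
        rw [map_sub, evalX_X, evalX_C]
        refine Commute.sub_left (X_mul_C j _) ?_
        rw [Commute, SemiconjBy, ← C_mul, ← C_mul, hbE i hi]
      rw [smul_smul, (commute_X_evalX j i _).eq, mul_smul, ha i hi, smul_smul, hcomm.eq, mul_smul]
    · rw [smul_smul, ← map_mul]
      have : Q.map E.subtype * (Polynomial.X - Polynomial.C (b : D)) = p := by
        rw [← hPmap, hQ]
        simp
      rw [this, hpm]
  exact hQ0 (Polynomial.map_injective _ E.subtype_injective (by rw [hQz, Polynomial.map_zero]))

/-- If the centralizers of commuting tuples are right algebraically closed, every simple module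
contains a simultaneous eigenvector of the indeterminates. -/
theorem exists_eigenvector {k : ℕ} [Module (CentralPoly D (k + 1)) M]
    [IsSimpleModule (CentralPoly D (k + 1)) M]
    (hRAC : ∀ a ∈ commutingTuples D k, IsRightAlgClosed (tupleCentralizer a)) :
    ∃ a ∈ commutingTuples D (k + 1), ∃ m : M, m ≠ 0 ∧
      ∀ i, (X i : CentralPoly D (k + 1)) • m = (C (a i) : CentralPoly D (k + 1)) • m := by
  -- Untreated coordinates are set to `0`, which does not change centralizers, so the hypothesis on
  -- `k`-tuples covers shorter ones.
  suffices H : ∀ l ≤ k + 1, ∃ a ∈ commutingTuples D (k + 1), ∃ m : M, m ≠ 0 ∧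
      (∀ i ∈ {i : Fin (k + 1) | i.val < l},
        (X i : CentralPoly D (k + 1)) • m = (C (a i) : CentralPoly D (k + 1)) • m) ∧
      ∀ i : Fin (k + 1), l ≤ i.val → a i = 0 by
    obtain ⟨a, ha, m, hm, h, -⟩ := H (k + 1) le_rfl
    exact ⟨a, ha, m, hm, fun i => h i i.2⟩
  intro l
  induction l with
  | zero =>
    intro _
    have : Nontrivial M := IsSimpleModule.nontrivial (CentralPoly D (k + 1)) M
    obtain ⟨m, hm⟩ := exists_ne (0 : M)
    exact ⟨0, fun _ _ => rfl, m, hm, fun i hi => absurd hi (Nat.not_lt_zero _), fun _ _ => rfl⟩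
  | succ l ih =>
    intro hl
    obtain ⟨a, ha, m, hm, heig, hzero⟩ := ih (by omega)
    have hE : ∀ d, d ∈ tupleCentralizer (fun i : Fin k => a i.castSucc) ↔
        ∀ i ∈ {i : Fin (k + 1) | i.val < l}, d * a i = a i * d := by
      intro d
      rw [Subring.mem_centralizer_iff, Set.forall_mem_range]
      constructor
      · intro h i hi
        have hi' : i.val < l := hi
        exact (h ⟨i.val, by omega⟩).symm
      · intro h i
        by_cases hi : i.castSucc.val < l
        · exact (h _ hi).symm
        · rw [hzero _ (not_lt.1 hi), zero_mul, mul_zero]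
    let j : Fin (k + 1) := ⟨l, by omega⟩
    obtain ⟨b, hb, m', hm', ha', hbm⟩ := exists_eigenvector_extension hE
      (hRAC _ fun i i' => ha _ _) j hm heig (exists_evalX_smul_eq_zero j m hm)
    have hbc : ∀ i, b * a i = a i * b := by
      intro i
      by_cases hi : i.val < l
      · exact (hE b).1 hb i hi
      · rw [hzero i (not_lt.1 hi), mul_zero, zero_mul]
    refine ⟨Function.update a j b, ?_, m', hm', ?_, ?_⟩
    · intro i i'
      by_cases hi : i = j <;> by_cases hi' : i' = j <;>
        simp [hi, hi', hbc, ha i i']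
    · intro i hi
      by_cases hij : i = j
      · subst hij; rw [Function.update_self]; exact hbm
      · rw [Function.update_of_ne hij]
        refine ha' i ?_
        have h1 : i.val ≠ l := fun h => hij (Fin.ext h)
        have h2 : i.val < l + 1 := hi
        change i.val < l
        omega
    · intro i hi
      rw [Function.update_of_ne (by rintro rfl; simp [j] at hi)]
      exact hzero i (by omega)

end CentralPoly

/-! ### Universal property and left ideals of points. -/

namespace CentralPoly

section Lift

variable {D : Type*} [Ring D] {n : ℕ} {S : Type*} [Ring S]

theorem pairwise_commute_pow {y : Fin n → S} (hy : ∀ i j, Commute (y i) (y j)) (β : Fin n → ℕ)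
    (t : Finset (Fin n)) : (t : Set (Fin n)).Pairwise (Function.onFun Commute fun i => y i ^ β i) :=
  fun i _ j _ _ => (hy i j).pow_pow _ _

/-- The monoid homomorphism sending a monomial to its value at a commuting tuple. -/
def monomialHom (y : Fin n → S) (hy : ∀ i j, Commute (y i) (y j)) :
    Multiplicative (Fin n →₀ ℕ) →* S where
  toFun β := Finset.univ.noncommProd (fun i => y i ^ β.toAdd i) (pairwise_commute_pow hy _ _)
  map_one' := by
    refine (Finset.noncommProd_eq_pow_card _ _ _ 1 fun i _ => ?_).trans (one_pow _)
    exact pow_zero _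
  map_mul' β γ := by
    refine Eq.trans ?_ (Finset.noncommProd_mul_distrib (fun i => y i ^ β.toAdd i)
      (fun i => y i ^ γ.toAdd i) (pairwise_commute_pow hy _ _) (pairwise_commute_pow hy _ _)
      fun i _ j _ _ => (hy i j).pow_pow _ _)
    exact Finset.noncommProd_congr rfl (fun i _ => pow_add _ _ _) _

theorem monomialHom_apply (y : Fin n → S) (hy : ∀ i j, Commute (y i) (y j))
    (β : Multiplicative (Fin n →₀ ℕ)) : monomialHom y hy β =
      Finset.univ.noncommProd (fun i => y i ^ β.toAdd i) (pairwise_commute_pow hy _ _) := rfl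

theorem monomialHom_single (y : Fin n → S) (hy : ∀ i j, Commute (y i) (y j)) (i : Fin n) :
    monomialHom y hy (.ofAdd (Finsupp.single i 1)) = y i := by
  have h := Finset.noncommProd_erase_mul Finset.univ (Finset.mem_univ i)
    (fun j => y j ^ (Finsupp.single i 1 : Fin n →₀ ℕ) j) (pairwise_commute_pow hy _ _)
  have h' : (Finset.univ.erase i).noncommProd (fun j => y j ^ (Finsupp.single i 1 : Fin n →₀ ℕ) j)
      (pairwise_commute_pow hy _ _) = 1 := by
    refine (Finset.noncommProd_eq_pow_card _ _ _ 1 fun j hj => ?_).trans (one_pow _)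
    rw [Finsupp.single_eq_of_ne (Finset.ne_of_mem_erase hj), pow_zero]
  refine h.symm.trans ((congrArg (· * _) h').trans ?_)
  rw [one_mul, Finsupp.single_eq_same, pow_one]

/-- The universal property of the polynomial ring in central indeterminates. -/
theorem exists_lift (f : D →+* S) (y : Fin n → S) (hy : ∀ i j, Commute (y i) (y j))
    (hf : ∀ d i, Commute (f d) (y i)) :
    ∃ θ : CentralPoly D n →+* S, (∀ d, θ (C d) = f d) ∧ ∀ i, θ (X i) = y i := by
  have hcomm : ∀ d β, Commute (f d) (monomialHom y hy β) := by
    intro d β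
    rw [monomialHom_apply]
    exact Finset.noncommProd_commute _ _ _ _ fun i _ => (hf d i).pow_right _
  refine ⟨AddMonoidAlgebra.liftNCRingHom f (monomialHom y hy) hcomm, fun d => ?_, fun i => ?_⟩
  · refine (AddMonoidAlgebra.liftNCRingHom_single _ _ _ _ _).trans ?_
    rw [ofAdd_zero, map_one, mul_one]
  · refine (AddMonoidAlgebra.liftNCRingHom_single _ _ _ _ _).trans ?_
    rw [map_one, one_mul, monomialHom_single]

/-- Specializing all but the last indeterminate to a commuting tuple `a`, a non-unit `p` whose
coefficients commute with `a` generates a proper left ideal. -/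
theorem exists_ideal_ne_top_of_commuting {k : ℕ} {a : Fin k → D} (ha : a ∈ commutingTuples D k)
    {p : Polynomial D} (hp : Ideal.span {p} ≠ ⊤)
    (hpa : ∀ i, p * Polynomial.C (a i) = Polynomial.C (a i) * p) :
    ∃ J : Ideal (CentralPoly D (k + 1)), J ≠ ⊤ ∧
      (∀ i : Fin k, X i.castSucc - C (a i) ∈ J) ∧ evalX (Fin.last k) p ∈ J := by
  let I : Ideal (Polynomial D) := Ideal.span {p}
  let c : Fin (k + 1) → Polynomial D := Fin.snoc (fun i => Polynomial.C (a i)) Polynomial.X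
  have hcs : ∀ i : Fin k, c i.castSucc = Polynomial.C (a i) := fun i => by simp [c]
  have hcl : c (Fin.last k) = Polynomial.X := by simp [c]
  have hcc : ∀ i j, c i * c j = c j * c i := by
    intro i j
    induction i using Fin.lastCases with
    | last => rw [hcl, Polynomial.X_mul]
    | cast i =>
      induction j using Fin.lastCases with
      | last => rw [hcl, Polynomial.X_mul]
      | cast j => rw [hcs, hcs, ← Polynomial.C_mul, ← Polynomial.C_mul, ha i j]
  have hpc : ∀ i, p * c i = c i * p := by
    intro i
    induction i using Fin.lastCases with
    | last => rw [hcl, Polynomial.X_mul]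
    | cast i => rw [hcs, hpa]
  let ρ : Fin (k + 1) → (Polynomial D →ₗ[Polynomial D] Polynomial D) :=
    fun i => LinearMap.toSpanSingleton (Polynomial D) (Polynomial D) (c i)
  have hρ : ∀ i, I ≤ Submodule.comap (ρ i) I := by
    intro i
    refine Ideal.span_le.2 (Set.singleton_subset_iff.2 ?_)
    change p * c i ∈ I
    rw [hpc]
    exact I.mul_mem_left _ (Ideal.mem_span_singleton_self p)
  let f := Module.toAddMonoidEnd (Polynomial D) (Polynomial D ⧸ I)
  -- Indeterminates act by right multiplication, so they commute with the left action of `D`.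
  let y : Fin (k + 1) → AddMonoid.End (Polynomial D ⧸ I) :=
    fun i => (Submodule.mapQ I I (ρ i) (hρ i)).toAddMonoidHom
  have hymk : ∀ i (q : Polynomial D), y i (Submodule.Quotient.mk q) =
      Submodule.Quotient.mk (q * c i) := fun i q => rfl
  have hfmk : ∀ r q : Polynomial D, f r (Submodule.Quotient.mk q) =
      Submodule.Quotient.mk (r * q) := fun r q => rfl
  have hyy : ∀ i j, Commute (y i) (y j) := by
    intro i j
    ext x
    obtain ⟨q, rfl⟩ := Submodule.Quotient.mk_surjective I x
    change y i (y j (Submodule.Quotient.mk q)) = y j (y i (Submodule.Quotient.mk q))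
    rw [hymk, hymk, hymk, hymk, mul_assoc, mul_assoc, hcc]
  have hfy : ∀ r i, Commute (f r) (y i) := by
    intro r i
    ext x
    obtain ⟨q, rfl⟩ := Submodule.Quotient.mk_surjective I x
    change f r (y i (Submodule.Quotient.mk q)) = y i (f r (Submodule.Quotient.mk q))
    rw [hymk, hfmk, hfmk, hymk, mul_assoc]
  obtain ⟨θ, hθC, hθX⟩ := exists_lift (f.comp Polynomial.C) y hyy fun d i => hfy _ i
  have hθ : θ.comp (evalX (Fin.last k)) = f := by
    refine Polynomial.ringHom_ext (fun d => ?_) ?_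
    · rw [RingHom.comp_apply, evalX_C, hθC]; rfl
    · rw [RingHom.comp_apply, evalX_X, hθX]
      ext x
      obtain ⟨q, rfl⟩ := Submodule.Quotient.mk_surjective I x
      rw [hymk, hfmk, hcl, Polynomial.X_mul]
  let one : Polynomial D ⧸ I := Submodule.Quotient.mk 1
  -- The annihilator of the class of `1`.
  let J : Ideal (CentralPoly D (k + 1)) :=
    { carrier := {r | θ r one = 0}
      add_mem' := fun {r s} hr hs => by
        change θ (r + s) one = 0
        rw [map_add]
        change θ r one + θ s one = 0
        rw [show θ r one = 0 from hr, show θ s one = 0 from hs,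
          add_zero]
      zero_mem' := by
        change θ 0 one = 0
        rw [map_zero]; rfl
      smul_mem' := fun r s hs => by
        change θ (r * s) one = 0
        rw [map_mul]
        change θ r (θ s one) = 0
        rw [show θ s one = 0 from hs, map_zero] }
  refine ⟨J, ?_, fun i => ?_, ?_⟩
  · rw [Ideal.ne_top_iff_one]
    intro h
    have h' : θ 1 one = 0 := h
    rw [map_one] at h'
    exact hp ((Ideal.eq_top_iff_one _).2 ((Submodule.Quotient.mk_eq_zero I).1 h'))
  · change θ (X i.castSucc - C (a i)) one = 0
    rw [map_sub, hθX, hθC]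
    change y i.castSucc one - f (Polynomial.C (a i)) one = 0
    rw [hymk, hfmk, hcs, one_mul, mul_one, sub_self]
  · change θ (evalX (Fin.last k) p) one = 0
    rw [← RingHom.comp_apply, hθ, hfmk, mul_one]
    exact (Submodule.Quotient.mk_eq_zero I).2 (Ideal.mem_span_singleton_self p)

/-- The subgroup `D + L`, with `L` the point ideal, contains `1` and is stable under left
multiplication by constants and by `x_i`, since `x_i d = d(x_i - a_i) + d a_i`. -/
theorem exists_eq_C_add_mem_leftPointIdeal (a : Fin n → D) (r : CentralPoly D n) :
    ∃ d, ∃ l ∈ leftPointIdeal a, r = C d + l := by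
  suffices H : ∀ s, (∃ d, ∃ l ∈ leftPointIdeal a, s = C d + l) →
      ∃ d, ∃ l ∈ leftPointIdeal a, r * s = C d + l by
    simpa using H 1 ⟨1, 0, zero_mem _, by rw [C_one, add_zero]⟩
  refine induction_C_X (P := fun r => ∀ s, (∃ d, ∃ l ∈ leftPointIdeal a, s = C d + l) →
      ∃ d, ∃ l ∈ leftPointIdeal a, r * s = C d + l) r ?_ ?_ ?_ ?_
  · intro p q hp hq s hs
    obtain ⟨d, l, hl, h⟩ := hp s hs
    obtain ⟨d', l', hl', h'⟩ := hq s hs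
    refine ⟨d + d', l + l', add_mem hl hl', ?_⟩
    rw [add_mul, h, h', ← CHom_apply, ← CHom_apply, ← CHom_apply, map_add]
    abel
  · intro p q hp hq s hs
    rw [mul_assoc]
    exact hp _ (hq s hs)
  · rintro c _ ⟨d, l, hl, rfl⟩
    exact ⟨c * d, C c * l, Ideal.mul_mem_left _ _ hl, by rw [mul_add, C_mul]⟩
  · rintro i _ ⟨d, l, hl, rfl⟩
    refine ⟨d * a i, C d * (X i - C (a i)) + X i * l, add_mem (Ideal.mul_mem_left _ _
      (Ideal.subset_span ⟨i, rfl⟩)) (Ideal.mul_mem_left _ _ hl), ?_⟩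
    rw [mul_add, mul_sub, C_mul, X_mul_C]
    abel

end Lift

/-! ### Maximal left ideals and one-dimensional modules over a division ring. -/

section DivisionRing

variable {D : Type*} [DivisionRing D] {n k : ℕ}

theorem isUnit_C {d : D} (hd : d ≠ 0) : IsUnit (C d : CentralPoly D n) :=
  (IsUnit.mk0 d hd).map CHom

theorem eq_of_C_sub_C_mem {I : Ideal (CentralPoly D n)} (hI : I ≠ ⊤) {b c : D}
    (h : C b - C c ∈ I) : b = c := by
  by_contra hbc
  refine hI (Ideal.eq_top_of_isUnit_mem _ h ?_)
  rw [← CHom_apply, ← CHom_apply, ← map_sub]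
  exact isUnit_C (sub_ne_zero.2 hbc)

theorem span_singleton_ne_top_of_natDegree_pos {p : Polynomial D} (hp : 0 < p.natDegree) :
    Ideal.span {p} ≠ ⊤ := by
  rw [Ideal.ne_top_iff_one]
  intro h
  obtain ⟨q, hq⟩ := Ideal.mem_span_singleton'.1 h
  have := congrArg Polynomial.natDegree hq
  rw [Polynomial.natDegree_mul (by rintro rfl; simp at hq) (by rintro rfl; simp at hp),
    Polynomial.natDegree_one] at this
  omega

theorem leftPointIdeal_ne_top {a : Fin (k + 1) → D} (ha : a ∈ commutingTuples D (k + 1)) :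
    leftPointIdeal a ≠ ⊤ := by
  obtain ⟨J, hJ, h1, h2⟩ := exists_ideal_ne_top_of_commuting (a := fun i : Fin k => a i.castSucc)
    (fun i j => ha _ _) (p := Polynomial.X - Polynomial.C (a (Fin.last k)))
    (span_singleton_ne_top_of_natDegree_pos (by rw [Polynomial.natDegree_X_sub_C]; exact one_pos))
    (fun i => by
      rw [sub_mul, mul_sub, Polynomial.X_mul, ← Polynomial.C_mul, ← Polynomial.C_mul, ha])
  refine ne_top_of_le_ne_top hJ (Ideal.span_le.2 ?_)
  rintro _ ⟨i, rfl⟩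
  induction i using Fin.lastCases with
  | last => simpa using h2
  | cast i => exact h1 i

theorem eq_leftPointIdeal {a : Fin n → D} {I : Ideal (CentralPoly D n)} (hI : I ≠ ⊤)
    (h : leftPointIdeal a ≤ I) : I = leftPointIdeal a := by
  refine le_antisymm (fun r hr => ?_) h
  obtain ⟨d, l, hl, rfl⟩ := exists_eq_C_add_mem_leftPointIdeal a r
  have hd : C d - C 0 ∈ I := by
    rw [C_zero, sub_zero]
    exact (Ideal.add_mem_iff_left I (h hl)).1 hr
  rwa [eq_of_C_sub_C_mem hI hd, C_zero, zero_add]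

theorem leftPointIdeal_isMaximal {a : Fin (k + 1) → D} (ha : a ∈ commutingTuples D (k + 1)) :
    (leftPointIdeal a).IsMaximal := by
  obtain ⟨I, hI, hle⟩ := Ideal.exists_le_maximal _ (leftPointIdeal_ne_top ha)
  rwa [← eq_leftPointIdeal hI.ne_top hle]

/-- The maximal left ideals are the left ideals of points as soon as each of them contains the
left ideal of a point. -/
theorem setOf_isMaximal_eq_iff :
    {I : Ideal (CentralPoly D (k + 1)) | I.IsMaximal} =
        {I | ∃ a ∈ commutingTuples D (k + 1), I = leftPointIdeal a} ↔
      ∀ I : Ideal (CentralPoly D (k + 1)), I.IsMaximal → ∃ a : Fin (k + 1) → D,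
        ∀ i, X i - C (a i) ∈ I := by
  constructor
  · intro h I hI
    obtain ⟨a, -, rfl⟩ : I ∈ {I | ∃ a ∈ commutingTuples D (k + 1), I = leftPointIdeal a} := h ▸ hI
    exact ⟨a, fun i => Ideal.subset_span ⟨i, rfl⟩⟩
  · intro h
    ext I
    constructor
    · intro hI
      obtain ⟨a, ha⟩ := h I hI
      refine ⟨a, fun i j => ?_, eq_leftPointIdeal hI.ne_top (Ideal.span_le.2 ?_)⟩
      -- Commutation is automatic: modulo `I`, `x_i x_j ≡ x_i a_j = a_j x_i ≡ a_j a_i`, and likewise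
      -- with `i` and `j` exchanged.
      · refine eq_of_C_sub_C_mem hI.ne_top ?_
        have h1 := I.add_mem (I.mul_mem_left (C (a i)) (ha j)) (I.mul_mem_left (X j) (ha i))
        have h2 := I.add_mem (I.mul_mem_left (C (a j)) (ha i)) (I.mul_mem_left (X i) (ha j))
        have h3 := I.sub_mem h2 h1
        have h4 : C (a j) * (X i - C (a i)) + X i * (X j - C (a j)) -
            (C (a i) * (X j - C (a j)) + X j * (X i - C (a i))) =
            (C (a i * a j) - C (a j * a i) : CentralPoly D (k + 1)) := by
          simp only [mul_sub, C_mul, X_mul_C, X_mul_X j i]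
          abel
        rwa [h4] at h3
      · rintro _ ⟨i, rfl⟩
        exact ha i
    · rintro ⟨a, ha, rfl⟩
      exact leftPointIdeal_isMaximal ha

/-- If all maximal left ideals are left ideals of points, centralizers of commuting tuples are
right algebraically closed. -/
theorem isRightAlgClosed_of_maximal
    (h : {I : Ideal (CentralPoly D (k + 1)) | I.IsMaximal} =
      {I | ∃ a ∈ commutingTuples D (k + 1), I = leftPointIdeal a})
    (a : Fin k → D) (ha : a ∈ commutingTuples D k) : IsRightAlgClosed (tupleCentralizer a) := by
  intro p hp
  let E := tupleCentralizer a
  have hpdeg : 0 < (p.map E.subtype).natDegree := by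
    rwa [Polynomial.natDegree_map_eq_of_injective E.subtype_injective]
  obtain ⟨J, hJ, hJa, hJp⟩ := exists_ideal_ne_top_of_commuting ha
    (span_singleton_ne_top_of_natDegree_pos hpdeg) (fun i => by
      ext m
      rw [Polynomial.coeff_mul_C, Polynomial.coeff_C_mul, Polynomial.coeff_map]
      exact (((p.coeff m).2 : _ ∈ Subring.centralizer (Set.range a)) (a i) ⟨i, rfl⟩).symm)
  obtain ⟨I, hI, hle⟩ := Ideal.exists_le_maximal J hJ
  obtain ⟨b, hb, rfl⟩ : I ∈ {I | ∃ a ∈ commutingTuples D (k + 1), I = leftPointIdeal a} := h ▸ hI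
  have hX : ∀ i, X i - C (b i) ∈ leftPointIdeal b := fun i => Ideal.subset_span ⟨i, rfl⟩
  have hab : ∀ i : Fin k, a i = b i.castSucc := fun i => by
    refine eq_of_C_sub_C_mem hI.ne_top ?_
    have := Ideal.sub_mem _ (hX i.castSucc) (hle (hJa i))
    rwa [sub_sub_sub_cancel_left] at this
  have hmem : b (Fin.last k) ∈ tupleCentralizer a := by
    rintro _ ⟨i, rfl⟩
    rw [hab, hb]
  refine ⟨⟨b (Fin.last k), hmem⟩, Subtype.ext ?_⟩
  -- Remainder theorem: `q(x) - q(b)` is a left multiple of `x - b`.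
  have heval : ∀ q : Polynomial D, C (q.eval (b (Fin.last k))) - evalX (Fin.last k) q ∈
      leftPointIdeal b := by
    intro q
    obtain ⟨Q, hQ⟩ := Polynomial.exists_eq_mul_X_sub_C
      (p := Polynomial.C (q.eval (b (Fin.last k))) - q) (a := b (Fin.last k)) (by simp)
    rw [← evalX_C (Fin.last k), ← map_sub, hQ, map_mul, map_sub, evalX_X, evalX_C]
    exact Ideal.mul_mem_left _ _ (hX _)
  have h1 : (p.map E.subtype).eval (b (Fin.last k)) = 0 := by
    refine eq_of_C_sub_C_mem hI.ne_top ?_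
    rw [C_zero, sub_zero]
    simpa using Ideal.add_mem _ (heval (p.map E.subtype)) (hle hJp)
  rw [Polynomial.eval_map] at h1
  refine Eq.trans ?_ h1
  exact Polynomial.hom_eval₂ p (RingHom.id E) E.subtype ⟨b (Fin.last k), hmem⟩

/-- The point ideal kills `m` and `R = D + L`, so `M = R m = D m`. -/
theorem rank_eq_one_of_eigenvector {M : Type*} [AddCommGroup M] [Module (CentralPoly D n) M]
    [Module D M] [IsScalarTower D (CentralPoly D n) M] [IsSimpleModule (CentralPoly D n) M]
    {a : Fin n → D} {m : M} (hm : m ≠ 0)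
    (h : ∀ i, (X i : CentralPoly D n) • m = (C (a i) : CentralPoly D n) • m) :
    Module.rank D M = 1 := by
  refine rank_eq_one m hm fun w => ?_
  obtain ⟨r, rfl⟩ := IsSimpleModule.toSpanSingleton_surjective (CentralPoly D n) hm w
  obtain ⟨d, l, hl, rfl⟩ := exists_eq_C_add_mem_leftPointIdeal a r
  have hle : leftPointIdeal a ≤ LinearMap.ker (LinearMap.toSpanSingleton (CentralPoly D n) M m) := by
    refine Ideal.span_le.2 ?_
    rintro _ ⟨i, rfl⟩
    change (X i - C (a i)) • m = 0
    rw [sub_smul, h, sub_self]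
  refine ⟨d, ?_⟩
  rw [map_add, LinearMap.mem_ker.1 (hle hl), add_zero, LinearMap.toSpanSingleton_apply,
    ← mul_one (C d), ← smul_eq_C_mul, smul_assoc, one_smul]

theorem exists_point_of_rank_eq_one {I : Ideal (CentralPoly D n)} (hI : I ≠ ⊤)
    (h : Module.rank D (CentralPoly D n ⧸ I) = 1) : ∃ a : Fin n → D, ∀ i, X i - C (a i) ∈ I := by
  have h1 : (Submodule.Quotient.mk 1 : CentralPoly D n ⧸ I) ≠ 0 := by
    rw [Ne, Submodule.Quotient.mk_eq_zero]
    exact (Ideal.ne_top_iff_one I).1 hI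
  have hfin : Module.finrank D (CentralPoly D n ⧸ I) = 1 :=
    Module.rank_eq_one_iff_finrank_eq_one.1 h
  choose a ha using fun i => exists_smul_eq_of_finrank_eq_one hfin h1
    (Submodule.Quotient.mk (X i) : CentralPoly D n ⧸ I)
  refine ⟨a, fun i => ?_⟩
  rw [← Submodule.Quotient.mk_eq_zero, Submodule.Quotient.mk_sub, ← ha, ← mul_one (C (a i)),
    ← smul_eq_C_mul, Submodule.Quotient.mk_smul, sub_self]

end DivisionRing

end CentralPoly

/-! ### Passage to the opposite ring. -/

open MulOpposite in
theorem tupleCentralizer_op {D : Type*} [Ring D] {n : ℕ} (a : Fin n → D) (d : D) :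
    op d ∈ tupleCentralizer (fun i => op (a i)) ↔ d ∈ tupleCentralizer a := by
  rw [Subring.mem_centralizer_iff, Subring.mem_centralizer_iff, Set.forall_mem_range,
    Set.forall_mem_range]
  refine forall_congr' fun i => ?_
  rw [← op_mul, ← op_mul, op_inj, eq_comm]

open MulOpposite in
/-- The centralizer of a tuple in the opposite ring is the opposite of the centralizer. -/
def tupleCentralizerOpEquiv {D : Type*} [Ring D] {n : ℕ} (a : Fin n → D) :
    (tupleCentralizer a)ᵐᵒᵖ ≃+* tupleCentralizer (fun i => op (a i)) where
  toFun x := ⟨op (x.unop : D), (tupleCentralizer_op a _).2 x.unop.2⟩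
  invFun y := op ⟨(y : Dᵐᵒᵖ).unop, (tupleCentralizer_op a _).1 y.2⟩
  left_inv _ := rfl
  right_inv _ := rfl
  map_mul' _ _ := rfl
  map_add' _ _ := rfl

theorem commutingTuples_op {D : Type*} [Ring D] {n : ℕ} (a : Fin n → D) :
    (fun i => MulOpposite.op (a i)) ∈ commutingTuples Dᵐᵒᵖ n ↔ a ∈ commutingTuples D n := by
  refine forall_congr' fun i => forall_congr' fun j => ?_
  rw [← MulOpposite.op_mul, ← MulOpposite.op_mul, MulOpposite.op_inj, eq_comm]

theorem isRightAlgClosed_tupleCentralizer_op_iff {D : Type*} [DivisionRing D] {n : ℕ}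
    (a : Fin n → D) : IsRightAlgClosed (tupleCentralizer fun i => MulOpposite.op (a i)) ↔
      IsRightAlgClosed (tupleCentralizer a) := by
  constructor
  · intro h
    have hu : ∀ c : (tupleCentralizer a)ᵐᵒᵖ, c ≠ 0 → IsUnit c := by
      intro c hc
      have := (isUnit_of_mem_tupleCentralizer c.unop
        fun h => hc (MulOpposite.unop_injective h)).op
      rwa [MulOpposite.op_unop] at this
    have := (h.of_ringEquiv (tupleCentralizerOpEquiv a).symm).op hu
    exact this.of_ringEquiv (RingEquiv.opOp _).symm
  · intro h
    exact (h.op isUnit_of_mem_tupleCentralizer).of_ringEquiv (tupleCentralizerOpEquiv a)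

namespace CentralPoly

open MulOpposite

variable {D : Type*} [Ring D] {n : ℕ}

/-- The polynomial ring over the opposite ring is the opposite of the polynomial ring. -/
theorem exists_opRingEquiv : ∃ e : CentralPoly Dᵐᵒᵖ n ≃+* (CentralPoly D n)ᵐᵒᵖ,
    (∀ d : D, e (C (op d)) = op (C d)) ∧ ∀ i, e (X i) = op (X i) := by
  obtain ⟨θ, hθC, hθX⟩ := exists_lift (n := n) (RingHom.op (CHom : D →+* CentralPoly D n))
    (fun i => op (X i)) (fun i j => congrArg op (X_mul_X j i))
    (fun d i => congrArg op (X_mul_C i d.unop))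
  obtain ⟨η, hηC, hηX⟩ := exists_lift (n := n)
    ((RingHom.op (CHom : Dᵐᵒᵖ →+* CentralPoly Dᵐᵒᵖ n)).comp (RingEquiv.opOp D).toRingHom)
    (fun i => op (X i)) (fun i j => congrArg op (X_mul_X j i))
    (fun d i => congrArg op (X_mul_C i (op d)))
  have hθC' : ∀ d : D, θ (C (op d)) = op (C d) := fun d => hθC (op d)
  have hηC' : ∀ d : D, η (C d) = op (C (op d)) := hηC
  have h1 : ∀ r, (η (θ r).unop).unop = r := fun r =>
    induction_C_X (P := fun r => (η (θ r).unop).unop = r) r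
      (fun p q hp hq => by simp [hp, hq]) (fun p q hp hq => by simp [hp, hq])
      (fun d => by rw [← op_unop d, hθC', unop_op, hηC', unop_op])
      (fun i => by rw [hθX, unop_op, hηX, unop_op])
  have h2 : ∀ r, (θ (η r).unop).unop = r := fun r =>
    induction_C_X (P := fun r => (θ (η r).unop).unop = r) r
      (fun p q hp hq => by simp [hp, hq]) (fun p q hp hq => by simp [hp, hq])
      (fun d => by rw [hηC', unop_op, hθC', unop_op])
      (fun i => by rw [hηX, unop_op, hθX, unop_op])
  exact ⟨RingEquiv.ofBijective θ ⟨fun r s h => by rw [← h1 r, h, h1],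
    fun r => ⟨(η r.unop).unop, unop_injective (h2 r.unop)⟩⟩, hθC', hθX⟩

/-- Left ideals over the opposite ring correspond to right ideals, compatibly with points. -/
theorem exists_orderIso_op : ∃ o : Ideal (CentralPoly Dᵐᵒᵖ n) ≃o
      Submodule (CentralPoly D n)ᵐᵒᵖ (CentralPoly D n),
    ∀ a : Fin n → D, o (leftPointIdeal fun i => op (a i)) = rightPointIdeal a := by
  obtain ⟨e, heC, heX⟩ := exists_opRingEquiv (D := D) (n := n)
  let : RingHomInvPair (e : CentralPoly Dᵐᵒᵖ n →+* (CentralPoly D n)ᵐᵒᵖ)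
    (e.symm : (CentralPoly D n)ᵐᵒᵖ →+* CentralPoly Dᵐᵒᵖ n) := RingHomInvPair.of_ringEquiv e
  let : RingHomInvPair (e.symm : (CentralPoly D n)ᵐᵒᵖ →+* CentralPoly Dᵐᵒᵖ n)
    (e : CentralPoly Dᵐᵒᵖ n →+* (CentralPoly D n)ᵐᵒᵖ) := RingHomInvPair.of_ringEquiv e.symm
  let φ : CentralPoly Dᵐᵒᵖ n ≃ₛₗ[(e : CentralPoly Dᵐᵒᵖ n →+* (CentralPoly D n)ᵐᵒᵖ)]
      CentralPoly D n :=
    { (e.toAddEquiv.trans opAddEquiv.symm) with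
      map_smul' := fun r s => congrArg unop (map_mul e r s) }
  refine ⟨Submodule.orderIsoMapComap φ, fun a => ?_⟩
  change Submodule.map φ.toLinearMap (Submodule.span _ _) = Submodule.span _ _
  rw [Submodule.map_span, ← Set.range_comp]
  congr 2
  funext i
  change unop (e (X i - C (op (a i)))) = _
  rw [map_sub, heC, heX, unop_sub, unop_op, unop_op]

theorem setOf_isCoatom_right_eq_iff :
    {I : Submodule (CentralPoly D n)ᵐᵒᵖ (CentralPoly D n) | IsCoatom I} =
        {I | ∃ a ∈ commutingTuples D n, I = rightPointIdeal a} ↔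
      {I : Ideal (CentralPoly Dᵐᵒᵖ n) | I.IsMaximal} =
        {I | ∃ a ∈ commutingTuples Dᵐᵒᵖ n, I = leftPointIdeal a} := by
  obtain ⟨o, ho⟩ := exists_orderIso_op (D := D) (n := n)
  have hmem : ∀ I : Ideal (CentralPoly Dᵐᵒᵖ n),
      (∃ a ∈ commutingTuples Dᵐᵒᵖ n, I = leftPointIdeal a) ↔
        ∃ a ∈ commutingTuples D n, o I = rightPointIdeal a := by
    intro I
    constructor
    · rintro ⟨a, ha, rfl⟩
      exact ⟨fun i => (a i).unop, (commutingTuples_op _).1 ha, ho fun i => (a i).unop⟩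
    · rintro ⟨a, ha, h⟩
      exact ⟨_, (commutingTuples_op a).2 ha, o.injective (h.trans (ho a).symm)⟩
  rw [Set.ext_iff, Set.ext_iff, o.surjective.forall]
  refine forall_congr' fun I => ?_
  rw [Set.mem_ofPred_eq, Set.mem_ofPred_eq, Set.mem_ofPred_eq, Set.mem_ofPred_eq, hmem,
    o.isCoatom_iff, Ideal.isMaximal_def]

end CentralPoly

/-! ### The equivalences. -/

theorem tfae_isMaximal_isSimpleModule_isRightAlgClosed {D : Type u} [DivisionRing D] {k : ℕ} :
    List.TFAE [
      {I : Ideal (CentralPoly D (k + 1)) | I.IsMaximal} =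
        {I | ∃ a ∈ commutingTuples D (k + 1), I = CentralPoly.leftPointIdeal a},
      ∀ (M : Type u) [AddCommGroup M] [Module (CentralPoly D (k + 1)) M] [Module D M]
        [IsScalarTower D (CentralPoly D (k + 1)) M],
        IsSimpleModule (CentralPoly D (k + 1)) M → Module.rank D M = 1,
      ∀ a ∈ commutingTuples D k, IsRightAlgClosed (tupleCentralizer a)] := by
  tfae_have 1 → 3 := CentralPoly.isRightAlgClosed_of_maximal
  tfae_have 3 → 2 := by
    intro h M _ _ _ _ _
    obtain ⟨a, -, m, hm, ham⟩ := CentralPoly.exists_eigenvector (M := M) h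
    exact CentralPoly.rank_eq_one_of_eigenvector hm ham
  tfae_have 2 → 1 := by
    intro h
    refine CentralPoly.setOf_isMaximal_eq_iff.2 fun I hI => ?_
    have : IsSimpleModule (CentralPoly D (k + 1)) (CentralPoly D (k + 1) ⧸ I) :=
      isSimpleModule_iff_isCoatom.2 hI.out
    exact CentralPoly.exists_point_of_rank_eq_one hI.ne_top (h _ this)
  tfae_finish

theorem forall_isRightAlgClosed_op_iff {D : Type*} [DivisionRing D] {k : ℕ} :
    (∀ a ∈ commutingTuples Dᵐᵒᵖ k, IsRightAlgClosed (tupleCentralizer a)) ↔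
      ∀ a ∈ commutingTuples D k, IsRightAlgClosed (tupleCentralizer a) := by
  constructor
  · intro h a ha
    exact (isRightAlgClosed_tupleCentralizer_op_iff a).1 (h _ ((commutingTuples_op a).2 ha))
  · intro h a ha
    exact (isRightAlgClosed_tupleCentralizer_op_iff fun i => (a i).unop).2
      (h _ ((commutingTuples_op _).1 ha))

theorem mainTheorem1 (D : Type u) [DivisionRing D] (n : ℕ) (hn : 1 ≤ n) :
    List.TFAE [
      {I : Ideal (CentralPoly D n) | I.IsMaximal} =
        {I | ∃ a ∈ commutingTuples D n, I = CentralPoly.leftPointIdeal a},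
      ∀ (M : Type u) [AddCommGroup M] [Module (CentralPoly D n) M] [Module D M]
        [IsScalarTower D (CentralPoly D n) M],
        IsSimpleModule (CentralPoly D n) M → Module.rank D M = 1,
      ∀ a ∈ commutingTuples D (n - 1), IsRightAlgClosed (tupleCentralizer a),
      {I : Submodule (CentralPoly D n)ᵐᵒᵖ (CentralPoly D n) | IsCoatom I} =
        {I | ∃ a ∈ commutingTuples D n, I = CentralPoly.rightPointIdeal a}] := by
  obtain ⟨k, rfl⟩ : ∃ k, n = k + 1 := ⟨n - 1, by omega⟩
  rw [Nat.add_sub_cancel]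
  have h := tfae_isMaximal_isSimpleModule_isRightAlgClosed (D := D) (k := k)
  tfae_have 1 ↔ 2 := h.out 0 1
  tfae_have 1 ↔ 3 := h.out 0 2
  tfae_have 4 ↔ 3 :=
    CentralPoly.setOf_isCoatom_right_eq_iff.trans
      ((tfae_isMaximal_isSimpleModule_isRightAlgClosed.out 0 2).trans forall_isRightAlgClosed_op_iff)
  tfae_finish
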